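/- Let $x_0>0$, $d_1,d_2\in\mathbb R$, $\omega(a)=d_1a^2+d_2a^4$, let $\lambda\in C^1(\mathbb R)$ satisfy $\lambda(x_0)=0$, $\lambda'(x_0)<0$, $\lambda(0)<0$, and let $\mu,\kappa\in C^1(\mathbb R)$ with $\mu(\epsilon),\kappa(\epsilon)=O(\epsilon^2)$ as $\epsilon\to0$. On the extended phase space $\mathbb R^4\ni(x,y,z,\epsilon)$ consider the flow $$x'=xy,\quad y'=z^2-y^2-\lambda(x)+\mu(\epsilon),\quad z'=\epsilon(\omega(x)-\omega(x_0))-\kappa(\epsilon)-2yz,\quad \epsilon'=0 .$$ Let $(\rho_0,u_0)$ be the wave at $\epsilon=0$: $\rho_0>0$, $\rho_0'=\rho_0u_0$, $u_0'=-u_0^2-\lambda(\rho_0)$, $(\rho_0,u_0)\to(x_0,0)$ as $t\to\infty$ and $(\rho_0,u_0)\to(0,\sqrt{-\lambda(0)})$ as $t\to-\infty$; in phase space it is the curve $w(t)=(\rho_0(t),u_0(t),0,0)$. Let $M_\epsilon=\{(X(z,\epsilon),Y(z,\epsilon),z):|z|<\delta\}$, $|\epsilon|<\epsilon_0$, be a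 slow manifold: a $C^1$ family of locally invariant curves such that $M_0$ is a normally hyperbolic curve of equilibria ($Y(z,0)=0$, $\lambda(X(z,0))=z^2$, $X\lambda'(X)+4z^2<0$ at $X=X(z,0)$) with $X(0,0)=x_0$. Let $W^s(M_0)$ be the set of points of $\{\epsilon=0\}$ whose forward orbit converges to a point of $M_0$. Let $0<\eta<x_0<x_1$, $0<r\le\delta$, and let the graph $y=S(x,z,\epsilon)$ over $\eta<x<x_1$, $|z|<r$, $|\epsilon|<\epsilon_0$ be a stable manifold $W^s(M_\epsilon)$: $S$ is $C^1$, the graph is locally invariant, it contains $M_\epsilon$ for $|z|<r$, and its slice $\epsilon=0$ is contained in $W^s(M_0)$. Fix $t_0$ with $\rho_0(t_0)>\eta$. Put $\xi_1(t)=w'(t)$. Say that $\xi_2:\mathbb R\to\mathbb R^4$ is a *carried $z$-tangent vector* if it solves the variational equation along $w$, $\xi_2(t_0)$ is a multiple of the derivative of the graph with respect to $z$, $(0,\partial_zS,1,0)$ at $w(t_0)$, and its third component tends to $1$ as $t\to\infty$. Let $P_{xz\epsilon}=\delta x\wedge\delta z\wedge\delta\epsilon$. Then: 1. The wave lies on $W^s(M_0)$: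 $S(\rho_0(t),0,0)=u_0(t)$ whenever $\rho_0(t)>\eta$. 2. There is exactly one carried $z$-tangent vector, namely $\xi_2(t)=\bigl(0,0,x_0^2/\rho_0^2(t),0\bigr)$ for all $t$. 3. With this $\xi_2$, $$P_{xz\epsilon}(\xi_1(t),\xi_2(t),\xi_3)=x_0^2\,\frac{u_0(t)}{\rho_0(t)}$$ for every $t$ with $\rho_0(t)>\eta$ and every vector $\xi_3$ tangent to the graph at $w(t)$ with $\epsilon$-component $1$. The same formula holds for all $t\in\mathbb R$ if $\xi_3=\xi_3(t)$ is a solution of the variational equation along $w$ that at $t_0$ is tangent to the graph and has $\epsilon$-component $1$. -/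

import Mathlib

open Set Filter Topology Asymptotics

noncomputable section

namespace SlowWave

/-- The extended phase space with coordinates `(x, y, z, ε)`, numbered `0, 1, 2, 3`. -/
abbrev Phase : Type := Fin 4 → ℝ

/-- `ω(a) = d₁ a² + d₂ a⁴`. -/
def omega (d₁ d₂ a : ℝ) : ℝ := d₁ * a ^ 2 + d₂ * a ^ 4

/-- The extended vector field
`x' = x y`, `y' = z² - y² - lam x + μ ε`, `z' = ε (ω(x) - ω(x₀)) - κ ε - 2 y z`, `ε' = 0`. -/
def field (lam : ℝ → ℝ) (x₀ d₁ d₂ : ℝ) (μ κ : ℝ → ℝ) (p : Phase) : Phase :=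
  ![p 0 * p 1,
    p 2 ^ 2 - p 1 ^ 2 - lam (p 0) + μ (p 3),
    p 3 * (omega d₁ d₂ (p 0) - omega d₁ d₂ x₀) - κ (p 3) - 2 * p 1 * p 2,
    0]

/-- `(ρ, u)` is the wave at `ε = 0`: an orbit in the plane `z = 0`, with positive first component,
that goes from `(0, √(-lam 0))` to `(x₀, 0)`. -/
structure IsWave (lam : ℝ → ℝ) (x₀ : ℝ) (ρ u : ℝ → ℝ) : Prop where
  pos : ∀ t, 0 < ρ t
  deriv_rho : ∀ t, HasDerivAt ρ (ρ t * u t) t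
  deriv_u : ∀ t, HasDerivAt u (-(u t) ^ 2 - lam (ρ t)) t
  rho_top : Tendsto ρ atTop (𝓝 x₀)
  u_top : Tendsto u atTop (𝓝 0)
  rho_bot : Tendsto ρ atBot (𝓝 0)
  u_bot : Tendsto u atBot (𝓝 (Real.sqrt (-lam 0)))

/-- The wave as a curve in the extended phase space. -/
def wave (ρ u : ℝ → ℝ) (t : ℝ) : Phase := ![ρ t, u t, 0, 0]

/-- The two-dimensional surface `{(X (z, ε), Y (z, ε), z, ε)}` over `|z| < δ`, `|ε| < ε₀`. -/
def slowSurface (X Y : ℝ → ℝ → ℝ) (δ ε₀ : ℝ) : Set Phase :=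
  {p | |p 2| < δ ∧ |p 3| < ε₀ ∧ p 0 = X (p 2) (p 3) ∧ p 1 = Y (p 2) (p 3)}

/-- `(X, Y)` describes a slow manifold `M_ε`, for `|ε| < ε₀`, of the field `F`: a `C¹` family of
locally invariant curves, graphs over `|z| < δ`, such that `M_0` is a normally hyperbolic curve of
equilibria through `(x₀, 0, 0)`.  (The eigenvalues transverse to `M_0` at `(x, 0, z)` are the two
square roots of `-(x lam'(x) + 4 z²)`.) -/
structure IsSlowManifold (F : Phase → Phase) (lam : ℝ → ℝ) (x₀ δ ε₀ : ℝ)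
    (X Y : ℝ → ℝ → ℝ) : Prop where
  smooth_X : ContDiffOn ℝ 1 (fun q : ℝ × ℝ => X q.1 q.2) (Ioo (-δ) δ ×ˢ Ioo (-ε₀) ε₀)
  smooth_Y : ContDiffOn ℝ 1 (fun q : ℝ × ℝ => Y q.1 q.2) (Ioo (-δ) δ ×ˢ Ioo (-ε₀) ε₀)
  base : X 0 0 = x₀
  equilibria : ∀ z, |z| < δ → Y z 0 = 0 ∧ lam (X z 0) = z ^ 2
  hyperbolic : ∀ z, |z| < δ → X z 0 * deriv lam (X z 0) + 4 * z ^ 2 < 0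
  invariant : ∀ (γ : ℝ → Phase) (a b : ℝ), IsIntegralCurveOn γ (fun _ => F) (Icc a b) →
    (∀ t ∈ Icc a b, |γ t 2| < δ ∧ |γ t 3| < ε₀) →
    (∃ s ∈ Icc a b, γ s ∈ slowSurface X Y δ ε₀) →
    ∀ t ∈ Icc a b, γ t ∈ slowSurface X Y δ ε₀

/-- `W^s(M_0)`: the points whose forward orbit exists for all time and converges to a point
of `M_0`. -/
def stableSetZero (F : Phase → Phase) (δ : ℝ) (X Y : ℝ → ℝ → ℝ) : Set Phase :=
  {p | ∃ γ : ℝ → Phase, IsIntegralCurveOn γ (fun _ => F) (Ici 0) ∧ γ 0 = p ∧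
    ∃ z, |z| < δ ∧ Tendsto γ atTop (𝓝 ![X z 0, Y z 0, z, 0])}

/-- The map `(x, z, ε) ↦ (x, S (x, z, ε), z, ε)`. -/
def graphMap (S : ℝ → ℝ → ℝ → ℝ) (q : ℝ × ℝ × ℝ) : Phase :=
  ![q.1, S q.1 q.2.1 q.2.2, q.2.1, q.2.2]

/-- The box `η < x < x₁`, `|z| < r`, `|ε| < ε₀`. -/
def box (η x₁ r ε₀ : ℝ) : Set (ℝ × ℝ × ℝ) :=
  Ioo η x₁ ×ˢ Ioo (-r) r ×ˢ Ioo (-ε₀) ε₀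

/-- The graph `y = S (x, z, ε)` over the box is (a piece of) the stable manifold `W^s(M_ε)` of the
slow manifold `(X, Y)`: a three-dimensional `C¹` graph, locally invariant under the flow, that
contains `M_ε` and whose slice `ε = 0` consists of points of `W^s(M_0)`. -/
structure IsStableGraph (F : Phase → Phase) (δ ε₀ : ℝ) (X Y : ℝ → ℝ → ℝ) (η x₁ r : ℝ)
    (S : ℝ → ℝ → ℝ → ℝ) : Prop where
  smooth : ContDiffOn ℝ 1 (fun q : ℝ × ℝ × ℝ => S q.1 q.2.1 q.2.2) (box η x₁ r ε₀)
  contains_slow : ∀ z ε, |z| < r → |ε| < ε₀ →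
    X z ε ∈ Ioo η x₁ ∧ S (X z ε) z ε = Y z ε
  invariant : ∀ (γ : ℝ → Phase) (a b : ℝ), IsIntegralCurveOn γ (fun _ => F) (Icc a b) →
    (∀ t ∈ Icc a b, (γ t 0, γ t 2, γ t 3) ∈ box η x₁ r ε₀) →
    (∃ s ∈ Icc a b, γ s ∈ graphMap S '' box η x₁ r ε₀) →
    ∀ t ∈ Icc a b, γ t ∈ graphMap S '' box η x₁ r ε₀
  slice_zero : ∀ x z, x ∈ Ioo η x₁ → |z| < r → graphMap S (x, z, 0) ∈ stableSetZero F δ X Y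

/-- The tangent space of the graph `y = S (x, z, ε)` at the point over `q`. -/
def tangentSpace (S : ℝ → ℝ → ℝ → ℝ) (q : ℝ × ℝ × ℝ) : Submodule ℝ Phase :=
  LinearMap.range (fderiv ℝ (graphMap S) q).toLinearMap

/-- The tangent vector `(0, ∂S/∂z, 1, 0)`, the derivative of the graph with respect to `z`. -/
def zTangent (S : ℝ → ℝ → ℝ → ℝ) (q : ℝ × ℝ × ℝ) : Phase :=
  fderiv ℝ (graphMap S) q (0, 1, 0)

/-- `ξ` solves the variational equation of the field `F` along the curve `c`. -/
def IsVariational (F : Phase → Phase) (c ξ : ℝ → Phase) : Prop :=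
  IsIntegralCurve ξ (fun t v => fderiv ℝ F (c t) v)

/-- `ξ` is the `z`-tangent vector of the graph carried along the wave: it solves the variational
equation, at time `t₀` it is a multiple of the derivative of the graph with respect to `z`, and it
is normalised by `δz → 1` as `t → ∞`. -/
structure IsCarriedZTangent (F : Phase → Phase) (S : ℝ → ℝ → ℝ → ℝ) (ρ u : ℝ → ℝ) (t₀ : ℝ)
    (ξ : ℝ → Phase) : Prop where
  variational : IsVariational F (wave ρ u) ξ
  initial : ∃ c : ℝ, ξ t₀ = c • zTangent S (ρ t₀, 0, 0)
  normalised : Tendsto (fun t => ξ t 2) atTop (𝓝 1)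

/-- The three-form `P_{xzε} = δx ∧ δz ∧ δε`: the `3 × 3` determinant of the `x`, `z` and `ε`
components of three vectors. -/
def Pxze : Phase [⋀^Fin 3]→ₗ[ℝ] ℝ :=
  (Matrix.detRowAlternating : (Fin 3 → ℝ) [⋀^Fin 3]→ₗ[ℝ] ℝ).compLinearMap
    (LinearMap.funLeft ℝ ℝ ![0, 2, 3])

theorem Pxze_apply (v w a : Phase) :
    Pxze ![v, w, a] = Matrix.det !![v 0, v 2, v 3; w 0, w 2, w 3; a 0, a 2, a 3] := by
  have h : Pxze ![v, w, a] = Matrix.det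
      (Matrix.of fun i j : Fin 3 => (![v, w, a] : Fin 3 → Phase) i ((![0, 2, 3] : Fin 3 → Fin 4) j)) :=
    rfl
  rw [h]
  congr 1
  ext i j
  fin_cases i <;> fin_cases j <;> rfl

end SlowWave

end

/-! On the slice `ε = 0` the flow conserves the angular momentum `x² z` and the energy `(xy)²/2 +
(xz)²/2 + V(x)` with `V' = x lam`. A point of `W^s(M_0)` therefore shares both with the equilibrium
it tends to (`conserved_of_tendsto`), which determines `S (x, z, 0)²` although `S` is not known
explicitly.

For `z = 0` the limit is `(x₀, 0, 0, 0)`, so `S² = u₀²` along the wave. The sign `S = -u₀` is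
impossible: the flow is reversed by `y ↦ -y` there, and a mirrored point runs to `x = 0`
(`graph_eq_wave`).

For small `z`, normal hyperbolicity makes the momentum a local coordinate on `M_0`, so the base
point depends differentiably on `z`. The energy along `M_0` is stationary at `z = 0` because `lam x₀
= 0`. Differentiating the energy identity gives `x² S ∂S/∂z = 0`, and `S = u₀ ≠ 0` leaves `∂S/∂z =
0` (`hasDerivAt_graph_z`). The initial direction is thus the pure `z` direction, which the
variational equation preserves, with solutions `c / ρ₀²`. The normalisation fixes `c = x₀²`, and the
three-form is a triangular determinant. -/

namespace SlowWave

/-! ### Uniqueness for differential equations -/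

/-- Uniqueness of forward orbits of an autonomous `C¹` vector field. -/
theorem eq_of_isIntegralCurveOn_Ici {F : Phase → Phase} (hF : ContDiff ℝ 1 F) {f g : ℝ → Phase}
    (hf : IsIntegralCurveOn f (fun _ => F) (Ici 0))
    (hg : IsIntegralCurveOn g (fun _ => F) (Ici 0)) (h0 : f 0 = g 0) :
    ∀ t, 0 ≤ t → f t = g t := by
  intro T hT
  have hsub : Icc 0 T ⊆ Ici (0 : ℝ) := Icc_subset_Ici_self
  have hfc := hf.continuousOn.mono hsub
  have hgc := hg.continuousOn.mono hsub
  -- A `C¹` field is only locally Lipschitz, so both compact arcs are enclosed in one closed ball.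
  obtain ⟨R₁, hR₁⟩ := isCompact_Icc.exists_bound_of_continuousOn hfc
  obtain ⟨R₂, hR₂⟩ := isCompact_Icc.exists_bound_of_continuousOn hgc
  obtain ⟨K, hK⟩ := (hF.contDiffOn (s := Metric.closedBall (0 : Phase) (max R₁ R₂))).exists_lipschitzOnWith
    one_ne_zero (convex_closedBall _ _) (isCompact_closedBall _ _)
  refine ODE_solution_unique_of_mem_Icc_right (v := fun _ => F)
    (s := fun _ => Metric.closedBall (0 : Phase) (max R₁ R₂)) (K := K) (a := 0) (b := T)
    (fun t _ => hK) hfc ?_ ?_ hgc ?_ ?_ h0 (right_mem_Icc.2 hT)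
  · exact fun t ht => (hf t ht.1).mono (Ici_subset_Ici.2 ht.1)
  · exact fun t ht => by
      simpa using (hR₁ t (Ico_subset_Icc_self ht)).trans (le_max_left _ _)
  · exact fun t ht => (hg t ht.1).mono (Ici_subset_Ici.2 ht.1)
  · exact fun t ht => by
      simpa using (hR₂ t (Ico_subset_Icc_self ht)).trans (le_max_right _ _)

theorem eq_of_hasDerivWithinAt_zero_Ici {f : ℝ → ℝ}
    (hf : ∀ t, 0 ≤ t → HasDerivWithinAt f 0 (Ici 0) t) : ∀ t, 0 ≤ t → f t = f 0 := by
  intro T hT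
  refine constant_of_has_deriv_right_zero (f := f) (a := 0) (b := T) ?_ ?_ T (right_mem_Icc.2 hT)
  · exact fun t ht => ((hf t ht.1).mono Icc_subset_Ici_self).continuousWithinAt
  · exact fun t ht => (hf t ht.1).mono (Ici_subset_Ici.2 ht.1)

/-- The solution of a linear equation with continuous coefficients is determined by its value at
one time. -/
theorem eq_of_linear_ode {A : ℝ → Phase →L[ℝ] Phase} (hA : Continuous A) {f g : ℝ → Phase}
    (hf : IsIntegralCurve f (fun t v => A t v)) (hg : IsIntegralCurve g (fun t v => A t v))
    {t₀ : ℝ} (h0 : f t₀ = g t₀) (t : ℝ) : f t = g t := by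
  obtain ⟨a, b, ht, ht₀⟩ : ∃ a b, t ∈ Ioo a b ∧ t₀ ∈ Ioo a b :=
    ⟨min t t₀ - 1, max t t₀ + 1, by grind, by grind⟩
  obtain ⟨C, hC⟩ := (isCompact_Icc (a := a) (b := b)).exists_bound_of_continuousOn hA.continuousOn
  refine ODE_solution_unique_of_mem_Ioo (v := fun t v => A t v) (s := fun _ => univ)
    (K := C.toNNReal) (fun s hs => ?_) ht₀ (fun s _ => ⟨hf s, mem_univ _⟩)
    (fun s _ => ⟨hg s, mem_univ _⟩) h0 ht
  refine ((A s).lipschitz.weaken ?_).lipschitzOnWith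
  rw [← NNReal.coe_le_coe, coe_nnnorm]
  exact (hC s (Ioo_subset_Icc_self hs)).trans (Real.le_coe_toNNReal C)

/-! ### Conserved quantities in the slice `ε = 0` -/

/-- The potential, a primitive of `x ↦ x lam x`. -/
noncomputable def potential (lam : ℝ → ℝ) (x : ℝ) : ℝ := ∫ s in (0 : ℝ)..x, s * lam s

theorem hasDerivAt_potential {lam : ℝ → ℝ} (hlam : Continuous lam) (x : ℝ) :
    HasDerivAt (potential lam) (x * lam x) x :=
  (continuous_id.mul hlam).integral_hasStrictDerivAt 0 x |>.hasDerivAt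

/-- The conserved energy of the flow in `ε = 0`. -/
noncomputable def energy (lam : ℝ → ℝ) (p : Phase) : ℝ :=
  (p 0 * p 1) ^ 2 / 2 + (p 0 * p 2) ^ 2 / 2 + potential lam (p 0)

theorem continuous_energy {lam : ℝ → ℝ} (hlam : Continuous lam) : Continuous (energy lam) := by
  have h : Continuous (potential lam) :=
    continuous_iff_continuousAt.2 fun x => (hasDerivAt_potential hlam x).continuousAt
  unfold energy
  fun_prop

theorem contDiff_field {lam μ κ : ℝ → ℝ} (hlam : ContDiff ℝ 1 lam) (hμ : ContDiff ℝ 1 μ)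
    (hκ : ContDiff ℝ 1 κ) (x₀ d₁ d₂ : ℝ) : ContDiff ℝ 1 (field lam x₀ d₁ d₂ μ κ) := by
  rw [contDiff_pi]
  intro i
  fin_cases i <;> simp [field, omega] <;> fun_prop

/-- A forward orbit in `ε = 0` with a limit has the angular momentum `x² z` and the energy of
its limit. -/
theorem conserved_of_tendsto {lam μ κ : ℝ → ℝ} (hlam : Continuous lam) (hμ : μ 0 = 0)
    (hκ : κ 0 = 0) {x₀ d₁ d₂ : ℝ} {γ : ℝ → Phase} {q : Phase}
    (hγ : IsIntegralCurveOn γ (fun _ => field lam x₀ d₁ d₂ μ κ) (Ici 0))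
    (h3 : γ 0 3 = 0) (hq : Tendsto γ atTop (𝓝 q)) :
    γ 0 0 ^ 2 * γ 0 2 = q 0 ^ 2 * q 2 ∧ energy lam (γ 0) = energy lam q := by
  have hd : ∀ i t, 0 ≤ t → HasDerivWithinAt (fun s => γ s i)
      (field lam x₀ d₁ d₂ μ κ (γ t) i) (Ici 0) t :=
    fun i t ht => hasDerivWithinAt_pi.1 (hγ t ht) i
  have hε : ∀ t, 0 ≤ t → γ t 3 = 0 := fun t ht =>
    (eq_of_hasDerivWithinAt_zero_Ici (f := fun s => γ s 3) (fun t ht => hd 3 t ht) t ht).trans h3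
  have lim : ∀ {f : Phase → ℝ}, Continuous f →
      (∀ t, 0 ≤ t → HasDerivWithinAt (fun s => f (γ s)) 0 (Ici 0) t) → f (γ 0) = f q := by
    intro f hf h
    refine tendsto_nhds_unique (Tendsto.congr' ?_ tendsto_const_nhds) ((hf.tendsto q).comp hq)
    filter_upwards [eventually_ge_atTop 0] with t ht
    exact (eq_of_hasDerivWithinAt_zero_Ici h t ht).symm
  constructor
  · refine lim (f := fun p => p 0 ^ 2 * p 2) (by fun_prop) fun t ht => ?_
    have h := ((hd 0 t ht).pow 2).mul (hd 2 t ht)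
    refine h.congr_deriv ?_
    simp [field, hε t ht, hκ]
    ring
  · refine lim (continuous_energy hlam) fun t ht => ?_
    have h := (((((hd 0 t ht).mul (hd 1 t ht)).pow 2).div_const 2).add
      ((((hd 0 t ht).mul (hd 2 t ht)).pow 2).div_const 2)).add
      ((hasDerivAt_potential hlam (γ t 0)).comp_hasDerivWithinAt t (hd 0 t ht))
    refine h.congr_deriv ?_
    simp [field, hε t ht, hκ, hμ]
    ring

/-! ### The wave, its mirror image and its monotonicity -/

section Wave

variable {lam μ κ : ℝ → ℝ} {x₀ d₁ d₂ : ℝ} {ρ u : ℝ → ℝ}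

theorem hasDerivAt_wave (hw : IsWave lam x₀ ρ u) (t : ℝ) :
    HasDerivAt (wave ρ u) ![ρ t * u t, -(u t) ^ 2 - lam (ρ t), 0, 0] t := by
  rw [hasDerivAt_pi]
  intro i
  fin_cases i
  · exact hw.deriv_rho t
  · exact hw.deriv_u t
  · exact hasDerivAt_const t (0 : ℝ)
  · exact hasDerivAt_const t (0 : ℝ)

theorem field_wave (hμ : μ 0 = 0) (hκ : κ 0 = 0) (a b : ℝ) :
    field lam x₀ d₁ d₂ μ κ ![a, b, 0, 0] = ![a * b, -b ^ 2 - lam a, 0, 0] := by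
  ext i
  fin_cases i <;> simp [field, hμ, hκ]

theorem isIntegralCurve_wave (hw : IsWave lam x₀ ρ u) (hμ : μ 0 = 0) (hκ : κ 0 = 0) (t : ℝ) :
    IsIntegralCurveOn (fun s => wave ρ u (t + s)) (fun _ => field lam x₀ d₁ d₂ μ κ) (Ici 0) := by
  intro s _
  have h := (hasDerivAt_wave hw (t + s)).comp_const_add t s
  refine (h.congr_deriv ?_).hasDerivWithinAt
  exact (field_wave hμ hκ _ _).symm

/-- The field is reversed by `y ↦ -y`. -/
theorem isIntegralCurve_reversed_wave (hw : IsWave lam x₀ ρ u) (hμ : μ 0 = 0) (hκ : κ 0 = 0)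
    (t : ℝ) : IsIntegralCurveOn (fun s => ![ρ (t - s), -u (t - s), 0, 0])
      (fun _ => field lam x₀ d₁ d₂ μ κ) (Ici 0) := by
  intro s _
  refine HasDerivAt.hasDerivWithinAt ?_
  beta_reduce
  rw [field_wave hμ hκ, hasDerivAt_pi]
  intro i
  fin_cases i
  · exact ((hw.deriv_rho (t - s)).comp_const_sub t s).congr_deriv (by simp)
  · exact ((hw.deriv_u (t - s)).comp_const_sub t s).neg.congr_deriv (by simp; ring)
  · exact hasDerivAt_const s (0 : ℝ)
  · exact hasDerivAt_const s (0 : ℝ)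

theorem tendsto_wave (hw : IsWave lam x₀ ρ u) (t : ℝ) :
    Tendsto (fun s => wave ρ u (t + s)) atTop (𝓝 ![x₀, 0, 0, 0]) := by
  have ht : Tendsto (fun s => t + s) atTop atTop := tendsto_atTop_add_const_left _ t tendsto_id
  rw [tendsto_pi_nhds]
  intro i
  fin_cases i
  · exact hw.rho_top.comp ht
  · exact hw.u_top.comp ht
  · exact tendsto_const_nhds
  · exact tendsto_const_nhds

/-- No forward orbit through a mirror image `(ρ, -u, 0, 0)` of a point of the wave converges to a
point with first coordinate other than `0`. -/
theorem eq_zero_of_orbit_reversed (hlam : ContDiff ℝ 1 lam) (hμ : ContDiff ℝ 1 μ)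
    (hκ : ContDiff ℝ 1 κ) (hw : IsWave lam x₀ ρ u) (hμ0 : μ 0 = 0) (hκ0 : κ 0 = 0) {t : ℝ}
    {γ : ℝ → Phase} {q : Phase}
    (hγ : IsIntegralCurveOn γ (fun _ => field lam x₀ d₁ d₂ μ κ) (Ici 0))
    (h0 : γ 0 = ![ρ t, -u t, 0, 0]) (hq : Tendsto γ atTop (𝓝 q)) : q 0 = 0 := by
  have h := eq_of_isIntegralCurveOn_Ici (contDiff_field hlam hμ hκ x₀ d₁ d₂) hγ
    (isIntegralCurve_reversed_wave hw hμ0 hκ0 t) (by simpa using h0)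
  have ht : Tendsto (fun s => t - s) atTop atBot :=
    tendsto_atBot_add_const_left _ t tendsto_neg_atTop_atBot
  refine tendsto_nhds_unique (tendsto_pi_nhds.1 hq 0) ((hw.rho_bot.comp ht).congr' ?_)
  filter_upwards [eventually_ge_atTop 0] with s hs
  simp [h s hs]

/-- Where `u` vanishes the wave meets its own mirror image, so its forward orbit would run back to
`ρ = 0` instead of `x₀`. The parameters `μ, κ, d₁, d₂` do not affect the plane `z = ε = 0` and are
set to zero. -/
theorem IsWave.u_ne_zero (hw : IsWave lam x₀ ρ u) (hlam : ContDiff ℝ 1 lam) (hx₀ : 0 < x₀)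
    (t : ℝ) : u t ≠ 0 := by
  intro h
  refine hx₀.ne' (eq_zero_of_orbit_reversed (μ := fun _ => 0) (κ := fun _ => 0) (d₁ := 0)
    (d₂ := 0) (t := t) hlam contDiff_const contDiff_const hw rfl rfl
    (isIntegralCurve_wave hw rfl rfl t) ?_ (tendsto_wave hw t))
  simp [wave, h]

theorem IsWave.u_pos (hw : IsWave lam x₀ ρ u) (hlam : ContDiff ℝ 1 lam) (hx₀ : 0 < x₀)
    (hlam0 : lam 0 < 0) (t : ℝ) : 0 < u t := by
  have hc : Continuous u := continuous_iff_continuousAt.2 fun t => (hw.deriv_u t).continuousAt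
  obtain ⟨s, hs⟩ := (hw.u_bot.eventually_const_lt (Real.sqrt_pos.2 (neg_pos.2 hlam0))).exists
  by_contra! h
  obtain ⟨a, -, ha⟩ := isPreconnected_univ.intermediate_value₂ (mem_univ t) (mem_univ s)
    hc.continuousOn continuousOn_const h hs.le
  exact hw.u_ne_zero hlam hx₀ a ha

/-- Since `ρ' = ρ u > 0`, the limit `x₀` is approached strictly from below; this keeps the wave
inside the domain of the graph. -/
theorem IsWave.rho_lt (hw : IsWave lam x₀ ρ u) (hlam : ContDiff ℝ 1 lam) (hx₀ : 0 < x₀)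
    (hlam0 : lam 0 < 0) (t : ℝ) : ρ t < x₀ := by
  have hm : StrictMono ρ := strictMono_of_hasDerivAt_pos hw.deriv_rho fun t =>
    mul_pos (hw.pos t) (hw.u_pos hlam hx₀ hlam0 t)
  exact (hm (lt_add_one t)).trans_le (hm.monotone.ge_of_tendsto hw.rho_top (t + 1))

end Wave

/-! ### The critical curve `M_0` and its momentum -/

section SlowManifold

variable {F : Phase → Phase} {lam : ℝ → ℝ} {x₀ δ ε₀ : ℝ} {X Y : ℝ → ℝ → ℝ}

theorem IsSlowManifold.differentiableAt (hM : IsSlowManifold F lam x₀ δ ε₀ X Y) (hε₀ : 0 < ε₀)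
    {z : ℝ} (hz : |z| < δ) : DifferentiableAt ℝ (fun z => X z 0) z := by
  have hmem : ((z, 0) : ℝ × ℝ) ∈ Ioo (-δ) δ ×ˢ Ioo (-ε₀) ε₀ :=
    ⟨abs_lt.1 hz, by simpa using hε₀, hε₀⟩
  have h := (hM.smooth_X.contDiffAt ((isOpen_Ioo.prod isOpen_Ioo).mem_nhds hmem)).differentiableAt
    one_ne_zero
  exact DifferentiableAt.comp z (f := fun z : ℝ => ((z, 0) : ℝ × ℝ)) h (by fun_prop)

/-- `X` starts at `x₀ > 0` and cannot reach `0`, where hyperbolicity would read `4 z² < 0`. -/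
theorem IsSlowManifold.pos (hM : IsSlowManifold F lam x₀ δ ε₀ X Y) (hε₀ : 0 < ε₀)
    (hx₀ : 0 < x₀) {z : ℝ} (hz : |z| < δ) : 0 < X z 0 := by
  have hδ : |(0 : ℝ)| < δ := by simpa using (abs_nonneg z).trans_lt hz
  have hc : ContinuousOn (fun z => X z 0) (Ioo (-δ) δ) := fun w hw =>
    (hM.differentiableAt hε₀ (abs_lt.2 hw)).continuousAt.continuousWithinAt
  by_contra! h
  obtain ⟨a, ha, h0⟩ := isPreconnected_Ioo.intermediate_value₂ (abs_lt.1 hz) (abs_lt.1 hδ)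
    hc continuousOn_const h (by simpa [hM.base] using hx₀.le)
  have := hM.hyperbolic a (abs_lt.2 ha)
  rw [h0] at this
  nlinarith [sq_nonneg a]

/-- Normal hyperbolicity: along the curve of equilibria, `x² z` has positive derivative. -/
theorem IsSlowManifold.hasDerivAt_momentum (hM : IsSlowManifold F lam x₀ δ ε₀ X Y) (hε₀ : 0 < ε₀)
    (hlam : ContDiff ℝ 1 lam) (hx₀ : 0 < x₀) {z : ℝ} (hz : |z| < δ) :
    ∃ m, 0 < m ∧ HasDerivAt (fun z => X z 0 ^ 2 * z) m z := by
  have hX := (hM.differentiableAt hε₀ hz).hasDerivAt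
  set X' := deriv (fun z => X z 0) z
  refine ⟨_, ?_, (hX.pow 2).mul (hasDerivAt_id z)⟩
  have hl := ((hlam.differentiable one_ne_zero (X z 0)).hasDerivAt).comp z hX
  have hsq : HasDerivAt (fun z : ℝ => z ^ 2) (2 * z) z := by simpa using hasDerivAt_pow 2 z
  have heq : deriv lam (X z 0) * X' = 2 * z := by
    refine hl.unique (hsq.congr_of_eventuallyEq ?_)
    filter_upwards [isOpen_Ioo.mem_nhds (abs_lt.1 hz)] with w hw
    exact (hM.equilibria w (abs_lt.2 hw)).2
  have hp := hM.pos hε₀ hx₀ hz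
  have hh := hM.hyperbolic z hz
  have hL : deriv lam (X z 0) < 0 := by
    by_contra! h
    nlinarith [sq_nonneg z, mul_nonneg hp.le h]
  -- The derivative of `X² z`, times `lam' < 0`, becomes the hyperbolicity expression times `X > 0`
  -- once `lam' X' = 2 z` is inserted; hence it is positive.
  have key : deriv lam (X z 0) * (2 * X z 0 * X' * z + X z 0 ^ 2)
      = X z 0 * (X z 0 * deriv lam (X z 0) + 4 * z ^ 2) := by
    linear_combination (2 * X z 0 * z) * heq
  have : 0 < 2 * X z 0 * X' * z + X z 0 ^ 2 := by
    by_contra! h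
    nlinarith [mul_nonneg_of_nonpos_of_nonpos hL.le h, mul_neg_of_pos_of_neg hp hh]
  simpa using this

end SlowManifold

/-! ### The stable graph along the wave -/

section Graph

variable {lam μ κ : ℝ → ℝ} {x₀ d₁ d₂ δ ε₀ η x₁ r : ℝ} {ρ u : ℝ → ℝ} {X Y : ℝ → ℝ → ℝ}
  {S : ℝ → ℝ → ℝ → ℝ}

/-- The conserved quantities at a point of the slice `ε = 0` of the stable graph. -/
theorem exists_base_point (hlam : Continuous lam) (hμ : μ 0 = 0) (hκ : κ 0 = 0)
    (hM : IsSlowManifold (field lam x₀ d₁ d₂ μ κ) lam x₀ δ ε₀ X Y)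
    (hS : IsStableGraph (field lam x₀ d₁ d₂ μ κ) δ ε₀ X Y η x₁ r S)
    {x z : ℝ} (hx : x ∈ Ioo η x₁) (hz : |z| < r) :
    ∃ ζ, |ζ| < δ ∧ X ζ 0 ^ 2 * ζ = x ^ 2 * z ∧
      (x * S x z 0) ^ 2 / 2 + (x * z) ^ 2 / 2 + potential lam x
        = (X ζ 0 * ζ) ^ 2 / 2 + potential lam (X ζ 0) ∧
      ∃ γ : ℝ → Phase, IsIntegralCurveOn γ (fun _ => field lam x₀ d₁ d₂ μ κ) (Ici 0) ∧
        γ 0 = ![x, S x z 0, z, 0] ∧ Tendsto γ atTop (𝓝 ![X ζ 0, 0, ζ, 0]) := by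
  obtain ⟨γ, hγ, h0, ζ, hζ, hlim⟩ := hS.slice_zero x z hx hz
  rw [(hM.equilibria ζ hζ).1] at hlim
  simp only [graphMap] at h0
  obtain ⟨h1, h2⟩ := conserved_of_tendsto hlam hμ hκ hγ (by simp [h0]) hlim
  refine ⟨ζ, hζ, ?_, ?_, γ, hγ, h0, hlim⟩
  · simpa [h0] using h1.symm
  · simpa [h0, energy] using h2

theorem momentum_strictMonoOn (hlam : ContDiff ℝ 1 lam) (hx₀ : 0 < x₀) (hε₀ : 0 < ε₀)
    {F : Phase → Phase} (hM : IsSlowManifold F lam x₀ δ ε₀ X Y) :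
    StrictMonoOn (fun z => X z 0 ^ 2 * z) (Ioo (-δ) δ) := by
  refine strictMonoOn_of_deriv_pos (convex_Ioo _ _) (fun z hz => ?_) (fun z hz => ?_)
  · obtain ⟨m, -, h⟩ := hM.hasDerivAt_momentum hε₀ hlam hx₀ (abs_lt.2 hz)
    exact h.continuousAt.continuousWithinAt
  · rw [interior_Ioo] at hz
    obtain ⟨m, hm, h⟩ := hM.hasDerivAt_momentum hε₀ hlam hx₀ (abs_lt.2 hz)
    rwa [h.deriv]

theorem graph_eq_wave (hlam : ContDiff ℝ 1 lam) (hμ : ContDiff ℝ 1 μ) (hκ : ContDiff ℝ 1 κ)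
    (hμ0 : μ 0 = 0) (hκ0 : κ 0 = 0) (hx₀ : 0 < x₀) (hlam0 : lam 0 < 0) (hx₁ : x₀ < x₁)
    (hr : 0 < r) (hε₀ : 0 < ε₀) (hw : IsWave lam x₀ ρ u)
    (hM : IsSlowManifold (field lam x₀ d₁ d₂ μ κ) lam x₀ δ ε₀ X Y)
    (hS : IsStableGraph (field lam x₀ d₁ d₂ μ κ) δ ε₀ X Y η x₁ r S)
    {t : ℝ} (ht : η < ρ t) : S (ρ t) 0 0 = u t := by
  obtain ⟨ζ, hζ, h1, h2, γ, hγ, h0, hlim⟩ := exists_base_point hlam.continuous hμ0 hκ0 hM hS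
    (x := ρ t) (z := 0) ⟨ht, (hw.rho_lt hlam hx₀ hlam0 t).trans hx₁⟩ (by simpa using hr)
  have hζ0 : ζ = 0 := by
    have := (hM.pos hε₀ hx₀ hζ).ne'
    simpa [this] using h1
  subst hζ0
  rw [hM.base] at h2 hlim
  have h3 := (conserved_of_tendsto hlam.continuous hμ0 hκ0
    (isIntegralCurve_wave (d₁ := d₁) (d₂ := d₂) hw hμ0 hκ0 t) (by simp [wave])
    (tendsto_wave hw t)).2
  norm_num at h2
  simp [energy, wave] at h3
  have hsq : S (ρ t) 0 0 ^ 2 = u t ^ 2 := by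
    have hp := pow_ne_zero 2 (hw.pos t).ne'
    refine mul_left_cancel₀ hp ?_
    linear_combination 2 * h2 - 2 * h3
  rcases sq_eq_sq_iff_eq_or_eq_neg.1 hsq with h | h
  · exact h
  -- With the wrong sign the orbit starts at a mirrored point, so its limit would have first
  -- coordinate `0` rather than `x₀`.
  · rw [h] at h0
    exact absurd (eq_zero_of_orbit_reversed hlam hμ hκ hw hμ0 hκ0 hγ h0 hlim) hx₀.ne'

theorem differentiableAt_graph {F : Phase → Phase} (hr : 0 < r) (hε₀ : 0 < ε₀)
    (hS : IsStableGraph F δ ε₀ X Y η x₁ r S) {x : ℝ} (hx : x ∈ Ioo η x₁) :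
    DifferentiableAt ℝ (fun q : ℝ × ℝ × ℝ => S q.1 q.2.1 q.2.2) (x, 0, 0) := by
  have hmem : ((x, 0, 0) : ℝ × ℝ × ℝ) ∈ box η x₁ r ε₀ :=
    ⟨hx, ⟨by simpa using hr, hr⟩, ⟨by simpa using hε₀, hε₀⟩⟩
  exact (hS.smooth.contDiffAt ((isOpen_Ioo.prod (isOpen_Ioo.prod isOpen_Ioo)).mem_nhds
    hmem)).differentiableAt one_ne_zero

/-- The stable graph is horizontal in the `z` direction along `z = ε = 0`. -/
theorem hasDerivAt_graph_z (hlam : ContDiff ℝ 1 lam)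
    (hμ0 : μ 0 = 0) (hκ0 : κ 0 = 0) (hx₀ : 0 < x₀) (hlam_x₀ : lam x₀ = 0) (hη : 0 < η)
    (hr : 0 < r) (hrδ : r ≤ δ) (hε₀ : 0 < ε₀)
    (hM : IsSlowManifold (field lam x₀ d₁ d₂ μ κ) lam x₀ δ ε₀ X Y)
    (hS : IsStableGraph (field lam x₀ d₁ d₂ μ κ) δ ε₀ X Y η x₁ r S)
    {x : ℝ} (hx : x ∈ Ioo η x₁) (hSx : S x 0 0 ≠ 0) :
    HasDerivAt (fun z => S x z 0) 0 0 := by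
  have hxp : x ≠ 0 := (hη.trans hx.1).ne'
  have hδ : 0 < δ := hr.trans_le hrδ
  have hδ0 : |(0 : ℝ)| < δ := by simpa using hδ
  have hd : DifferentiableAt ℝ (fun z => S x z 0) 0 :=
    DifferentiableAt.comp (0 : ℝ) (f := fun z : ℝ => ((x, z, 0) : ℝ × ℝ × ℝ))
      (differentiableAt_graph hr hε₀ hS hx) (by fun_prop)
  -- `Z z` will be the third coordinate of the limit point on `M_0`; the default value for `|z| ≥ r`
  -- is irrelevant near `0`.
  have hex : ∀ z, ∃ ζ, |z| < r → |ζ| < δ ∧ X ζ 0 ^ 2 * ζ = x ^ 2 * z ∧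
      (x * S x z 0) ^ 2 / 2 + (x * z) ^ 2 / 2 + potential lam x
        = (X ζ 0 * ζ) ^ 2 / 2 + potential lam (X ζ 0) := by
    intro z
    by_cases hz : |z| < r
    · obtain ⟨ζ, h1, h2, h3, -⟩ := exists_base_point hlam.continuous hμ0 hκ0 hM hS hx hz
      exact ⟨ζ, fun _ => ⟨h1, h2, h3⟩⟩
    · exact ⟨0, fun h => absurd h hz⟩
  choose Z hZ using hex
  have hnear : ∀ᶠ z in 𝓝 (0 : ℝ), |z| < r := by
    filter_upwards [isOpen_Ioo.mem_nhds (show (0 : ℝ) ∈ Ioo (-r) r from ⟨by simpa using hr, hr⟩)]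
      with z hz using abs_lt.2 hz
  have hZ0 : Z 0 = 0 := by
    obtain ⟨h1, h2, -⟩ := hZ 0 (by simpa using hr)
    have := (hM.pos hε₀ hx₀ h1).ne'
    simpa [this] using h2
  have hmono := momentum_strictMonoOn hlam hx₀ hε₀ hM
  obtain ⟨m, hm, hmd⟩ := hM.hasDerivAt_momentum hε₀ hlam hx₀ hδ0
  have hZc : ContinuousAt Z 0 := by
    rw [ContinuousAt, hZ0]
    refine tendsto_order.2 ⟨fun a ha => ?_, fun a ha => ?_⟩
    -- The bound is truncated at `-δ / 2` to stay in the interval where the momentum is strictly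
    -- monotone.
    · have hb : max a (-δ / 2) ∈ Ioo (-δ) δ := by constructor <;> grind
      have hb0 : max a (-δ / 2) < 0 := by grind
      have hneg : X (max a (-δ / 2)) 0 ^ 2 * max a (-δ / 2) < 0 :=
        mul_neg_of_pos_of_neg (pow_pos (hM.pos hε₀ hx₀ (abs_lt.2 hb)) 2) hb0
      have hlim : Tendsto (fun z : ℝ => x ^ 2 * z) (𝓝 0) (𝓝 0) := by
        simpa using (continuous_const_mul (x ^ 2)).tendsto (0 : ℝ)
      filter_upwards [hnear, hlim.eventually_const_lt hneg] with z hz h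
      obtain ⟨h1, h2, -⟩ := hZ z hz
      rw [← h2] at h
      exact (le_max_left _ _).trans_lt ((hmono.lt_iff_lt hb (abs_lt.1 h1)).1 h)
    · have hb : min a (δ / 2) ∈ Ioo (-δ) δ := by constructor <;> grind
      have hb0 : 0 < min a (δ / 2) := by grind
      have hpos : 0 < X (min a (δ / 2)) 0 ^ 2 * min a (δ / 2) :=
        mul_pos (pow_pos (hM.pos hε₀ hx₀ (abs_lt.2 hb)) 2) hb0
      have hlim : Tendsto (fun z : ℝ => x ^ 2 * z) (𝓝 0) (𝓝 0) := by
        simpa using (continuous_const_mul (x ^ 2)).tendsto (0 : ℝ)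
      filter_upwards [hnear, hlim.eventually_lt_const hpos] with z hz h
      obtain ⟨h1, h2, -⟩ := hZ z hz
      rw [← h2] at h
      exact ((hmono.lt_iff_lt (abs_lt.1 h1) hb).1 h).trans_le (min_le_left _ _)
  -- Momentum conservation says that `ζ ↦ X(ζ, 0)² ζ / x²` undoes `Z`, so `Z` inherits
  -- differentiability from its nonzero derivative.
  have hZd : HasDerivAt Z (m / x ^ 2)⁻¹ 0 := by
    refine HasDerivAt.of_local_left_inverse (f := fun z => X z 0 ^ 2 * z / x ^ 2) hZc ?_
      (div_ne_zero hm.ne' (pow_ne_zero 2 hxp)) ?_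
    · rw [hZ0]
      exact hmd.div_const _
    · filter_upwards [hnear] with z hz
      rw [(hZ z hz).2.1]
      field_simp
  have hXd := (hM.differentiableAt hε₀ hδ0).hasDerivAt
  -- The kinetic term is quadratic in `ζ`, and the potential term has derivative `x₀ lam x₀ X' = 0`.
  have hright : HasDerivAt (fun ζ => (X ζ 0 * ζ) ^ 2 / 2 + potential lam (X ζ 0)) 0 (Z 0) := by
    rw [hZ0]
    have h := (((hXd.mul (hasDerivAt_id 0)).pow 2).div_const 2).add
      (HasDerivAt.comp (h₂ := potential lam) (h := fun z => X z 0) (0 : ℝ)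
        (hasDerivAt_potential hlam.continuous (X 0 0)) hXd)
    refine h.congr_deriv ?_
    simp [hM.base, hlam_x₀]
  have hleft := (((hd.hasDerivAt.const_mul x).pow 2).div_const 2).add
    ((((hasDerivAt_id (0 : ℝ)).const_mul x).pow 2).div_const 2) |>.add_const (potential lam x)
  have heq := hleft.unique ((hright.comp (0 : ℝ) hZd).congr_of_eventuallyEq (by
    filter_upwards [hnear] with z hz
    exact (hZ z hz).2.2))
  have hd0 : deriv (fun z => S x z 0) 0 = 0 := by
    simpa [hxp, hSx] using heq
  exact hd.hasDerivAt.congr_deriv hd0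

theorem zTangent_eq {F : Phase → Phase} (hr : 0 < r) (hε₀ : 0 < ε₀)
    (hS : IsStableGraph F δ ε₀ X Y η x₁ r S) {x s : ℝ} (hx : x ∈ Ioo η x₁)
    (hs : HasDerivAt (fun z => S x z 0) s 0) : zTangent S (x, 0, 0) = ![0, s, 1, 0] := by
  have hg : DifferentiableAt ℝ (graphMap S) (x, 0, 0) := by
    rw [differentiableAt_pi]
    intro i
    fin_cases i
    · exact differentiableAt_fst
    · exact differentiableAt_graph hr hε₀ hS hx
    · exact differentiableAt_snd.fst
    · exact differentiableAt_snd.snd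
  have hl : HasDerivAt (fun z : ℝ => ((x, z, 0) : ℝ × ℝ × ℝ)) (0, 1, 0) 0 :=
    (hasDerivAt_const 0 x).prodMk ((hasDerivAt_id (0 : ℝ)).prodMk (hasDerivAt_const 0 (0 : ℝ)))
  refine (hg.hasFDerivAt.comp_hasDerivAt (0 : ℝ) hl).unique ?_
  rw [hasDerivAt_pi]
  intro i
  fin_cases i
  · exact hasDerivAt_const 0 x
  · exact hs
  · exact hasDerivAt_id (0 : ℝ)
  · exact hasDerivAt_const 0 (0 : ℝ)

end Graph

/-! ### The variational equation and the three-form -/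

section Variational

variable {lam μ κ : ℝ → ℝ} {x₀ d₁ d₂ : ℝ} {ρ u : ℝ → ℝ}

/-- At `z = ε = 0` the variable `z` enters `y'` only quadratically and `x'` not at all, so the `z`
direction is invariant under linearisation. -/
theorem fderiv_field_z (hF : ContDiff ℝ 1 (field lam x₀ d₁ d₂ μ κ)) (a b v : ℝ) :
    fderiv ℝ (field lam x₀ d₁ d₂ μ κ) ![a, b, 0, 0] ![0, 0, v, 0] = ![0, 0, -2 * b * v, 0] := by
  have hl : HasDerivAt (fun s : ℝ => (![a, b, s * v, 0] : Phase)) ![0, 0, v, 0] 0 := by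
    rw [hasDerivAt_pi]
    intro i
    fin_cases i
    · exact hasDerivAt_const 0 a
    · exact hasDerivAt_const 0 b
    · simpa using (hasDerivAt_id (0 : ℝ)).mul_const v
    · exact hasDerivAt_const 0 (0 : ℝ)
  have h0 : (![a, b, 0, 0] : Phase) = (fun s : ℝ => (![a, b, s * v, 0] : Phase)) 0 := by simp
  rw [h0]
  refine ((hF.differentiable one_ne_zero _).hasFDerivAt.comp_hasDerivAt (0 : ℝ) hl).unique ?_
  rw [hasDerivAt_pi]
  intro i
  fin_cases i
  · exact hasDerivAt_const 0 (a * b)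
  · have h := ((((hasDerivAt_id (0 : ℝ)).mul_const v).pow 2).sub_const (b ^ 2)).sub_const (lam a)
      |>.add_const (μ 0)
    exact h.congr_deriv (by simp)
  · have h := ((hasDerivAt_id (0 : ℝ)).mul_const v).const_mul (2 * b) |>.const_sub
      (0 * (omega d₁ d₂ a - omega d₁ d₂ x₀) - κ 0)
    exact h.congr_deriv (by simp)
  · exact hasDerivAt_const 0 (0 : ℝ)

theorem fderiv_field_three (hF : ContDiff ℝ 1 (field lam x₀ d₁ d₂ μ κ)) (p v : Phase) :
    fderiv ℝ (field lam x₀ d₁ d₂ μ κ) p v 3 = 0 := by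
  have h := hasFDerivAt_pi'.1 (hF.differentiable one_ne_zero p).hasFDerivAt 3
  have h' : HasFDerivAt (fun p => field lam x₀ d₁ d₂ μ κ p 3) (0 : Phase →L[ℝ] ℝ) p :=
    hasFDerivAt_const 0 p
  exact DFunLike.congr_fun (h.unique h') v

/-- This is the linearised conservation of `x² z`: `ρ' = ρ u` turns `v' = -2 u v` into `ρ² v = c`.
-/
theorem isVariational_z (hF : ContDiff ℝ 1 (field lam x₀ d₁ d₂ μ κ)) (hw : IsWave lam x₀ ρ u)
    (c : ℝ) : IsVariational (field lam x₀ d₁ d₂ μ κ) (wave ρ u)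
      (fun t => ![0, 0, c / ρ t ^ 2, 0]) := by
  intro t
  simp only [wave]
  rw [fderiv_field_z hF, hasDerivAt_pi]
  have hp := (hw.pos t).ne'
  intro i
  fin_cases i
  · exact hasDerivAt_const t (0 : ℝ)
  · exact hasDerivAt_const t (0 : ℝ)
  · refine ((hasDerivAt_const t c).div ((hw.deriv_rho t).pow 2) (pow_ne_zero 2 hp)).congr_deriv ?_
    simp
    field_simp
  · exact hasDerivAt_const t (0 : ℝ)

theorem IsVariational.eq_of_eq (hF : ContDiff ℝ 1 (field lam x₀ d₁ d₂ μ κ))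
    (hw : IsWave lam x₀ ρ u) {ξ ξ' : ℝ → Phase} {t₀ : ℝ}
    (h : IsVariational (field lam x₀ d₁ d₂ μ κ) (wave ρ u) ξ)
    (h' : IsVariational (field lam x₀ d₁ d₂ μ κ) (wave ρ u) ξ')
    (h0 : ξ t₀ = ξ' t₀) (t : ℝ) : ξ t = ξ' t :=
  eq_of_linear_ode (A := fun t => fderiv ℝ (field lam x₀ d₁ d₂ μ κ) (wave ρ u t))
    ((hF.continuous_fderiv one_ne_zero).comp
      (continuous_iff_continuousAt.2 fun t => (hasDerivAt_wave hw t).continuousAt)) h h' h0 t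

theorem IsVariational.three_eq (hF : ContDiff ℝ 1 (field lam x₀ d₁ d₂ μ κ)) {c ξ : ℝ → Phase}
    (h : IsVariational (field lam x₀ d₁ d₂ μ κ) c ξ) (s t : ℝ) : ξ s 3 = ξ t 3 := by
  have hd : ∀ t, HasDerivAt (fun s => ξ s 3) 0 t := fun t =>
    (hasDerivAt_pi.1 (h t) 3).congr_deriv (fderiv_field_three hF _ _)
  exact is_const_of_deriv_eq_zero (fun t => (hd t).differentiableAt) (fun t => (hd t).deriv) s t

theorem tendsto_z (hw : IsWave lam x₀ ρ u) (hx₀ : 0 < x₀) (c : ℝ) :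
    Tendsto (fun t => c / ρ t ^ 2) atTop (𝓝 (c / x₀ ^ 2)) :=
  tendsto_const_nhds.div (hw.rho_top.pow 2) (pow_ne_zero 2 hx₀.ne')

/-- The matrix is lower triangular with diagonal `ρ u`, `x₀² / ρ²`, `1`. -/
theorem Pxze_wave (hw : IsWave lam x₀ ρ u) (t : ℝ) {a : Phase} (ha : a 3 = 1) :
    Pxze ![deriv (wave ρ u) t, ![0, 0, x₀ ^ 2 / ρ t ^ 2, 0], a] = x₀ ^ 2 * (u t / ρ t) := by
  have hp := (hw.pos t).ne'
  rw [Pxze_apply, (hasDerivAt_wave hw t).deriv, Matrix.det_fin_three]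
  simp [ha]
  field_simp

end Variational

end SlowWave

theorem mainTheorem6
    -- the ordinary differential equation
    (lam : ℝ → ℝ) (x₀ d₁ d₂ : ℝ) (μ κ : ℝ → ℝ)
    (hlam : ContDiff ℝ 1 lam) (hx₀ : 0 < x₀)
    (hlam_x₀ : lam x₀ = 0) (hlam_deriv : deriv lam x₀ < 0) (hlam_zero : lam 0 < 0)
    (hμ : ContDiff ℝ 1 μ) (hμO : μ =O[𝓝 0] (fun ε : ℝ => ε ^ 2))
    (hκ : ContDiff ℝ 1 κ) (hκO : κ =O[𝓝 0] (fun ε : ℝ => ε ^ 2))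
    -- the wave at parameter value zero
    (ρ₀ u₀ : ℝ → ℝ) (hwave : SlowWave.IsWave lam x₀ ρ₀ u₀)
    -- the slow manifold and its stable manifold
    (δ ε₀ η x₁ r : ℝ) (hε₀ : 0 < ε₀) (hη : 0 < η) (hηx₀ : η < x₀) (hx₁ : x₀ < x₁)
    (hr : 0 < r) (hrδ : r ≤ δ)
    (X Y : ℝ → ℝ → ℝ) (S : ℝ → ℝ → ℝ → ℝ)
    (hM : SlowWave.IsSlowManifold (SlowWave.field lam x₀ d₁ d₂ μ κ) lam x₀ δ ε₀ X Y)
    (hS : SlowWave.IsStableGraph (SlowWave.field lam x₀ d₁ d₂ μ κ) δ ε₀ X Y η x₁ r S)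
    -- a time at which the wave has entered the region where the graph is defined
    (t₀ : ℝ) (ht₀ : η < ρ₀ t₀) :
    -- the wave lies on the stable manifold
    (∀ t, η < ρ₀ t → S (ρ₀ t) 0 0 = u₀ t) ∧
    -- the carried tangent vector in the third coordinate direction exists, and is as claimed
    SlowWave.IsCarriedZTangent (SlowWave.field lam x₀ d₁ d₂ μ κ) S ρ₀ u₀ t₀
      (fun t => ![0, 0, x₀ ^ 2 / ρ₀ t ^ 2, 0]) ∧
    ∀ ξ₂ : ℝ → SlowWave.Phase,
      SlowWave.IsCarriedZTangent (SlowWave.field lam x₀ d₁ d₂ μ κ) S ρ₀ u₀ t₀ ξ₂ →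
      (∀ t, ξ₂ t = ![0, 0, x₀ ^ 2 / ρ₀ t ^ 2, 0]) ∧
      -- the three-form on tangent vectors of the stable manifold at the wave
      (∀ t, η < ρ₀ t → ∀ ξ₃ ∈ SlowWave.tangentSpace S (ρ₀ t, 0, 0), ξ₃ 3 = 1 →
        SlowWave.Pxze ![deriv (SlowWave.wave ρ₀ u₀) t, ξ₂ t, ξ₃]
          = x₀ ^ 2 * (u₀ t / ρ₀ t)) ∧
      -- the same for a third vector that is carried by the variational equation
      (∀ ξ₃ : ℝ → SlowWave.Phase,
        SlowWave.IsVariational (SlowWave.field lam x₀ d₁ d₂ μ κ)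
          (SlowWave.wave ρ₀ u₀) ξ₃ →
        ξ₃ t₀ ∈ SlowWave.tangentSpace S (ρ₀ t₀, 0, 0) → ξ₃ t₀ 3 = 1 →
        ∀ t, SlowWave.Pxze ![deriv (SlowWave.wave ρ₀ u₀) t, ξ₂ t, ξ₃ t]
          = x₀ ^ 2 * (u₀ t / ρ₀ t)) := by
  have hμ0 : μ 0 = 0 := hμO.eq_zero_imp.self_of_nhds (by simp)
  have hκ0 : κ 0 = 0 := hκO.eq_zero_imp.self_of_nhds (by simp)
  have hF := SlowWave.contDiff_field hlam hμ hκ x₀ d₁ d₂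
  have hgraph : ∀ t, η < ρ₀ t → S (ρ₀ t) 0 0 = u₀ t := fun t ht =>
    SlowWave.graph_eq_wave hlam hμ hκ hμ0 hκ0 hx₀ hlam_zero hx₁ hr hε₀ hwave hM hS ht
  have hx : ρ₀ t₀ ∈ Ioo η x₁ := ⟨ht₀, (hwave.rho_lt hlam hx₀ hlam_zero t₀).trans hx₁⟩
  have hz : SlowWave.zTangent S (ρ₀ t₀, 0, 0) = ![0, 0, 1, 0] :=
    SlowWave.zTangent_eq hr hε₀ hS hx (SlowWave.hasDerivAt_graph_z hlam hμ0 hκ0 hx₀ hlam_x₀ hη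
      hr hrδ hε₀ hM hS hx (by rw [hgraph t₀ ht₀]; exact hwave.u_ne_zero hlam hx₀ t₀))
  refine ⟨hgraph, ⟨SlowWave.isVariational_z hF hwave _, ⟨x₀ ^ 2 / ρ₀ t₀ ^ 2, ?_⟩, ?_⟩, ?_⟩
  · simp [hz]
  · have h := SlowWave.tendsto_z hwave hx₀ (x₀ ^ 2)
    rw [div_self (pow_ne_zero 2 hx₀.ne')] at h
    exact h
  intro ξ₂ h₂
  have hξ₂ : ∀ t, ξ₂ t = ![0, 0, x₀ ^ 2 / ρ₀ t ^ 2, 0] := by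
    obtain ⟨c, hc⟩ := h₂.initial
    have hp := pow_ne_zero 2 (hwave.pos t₀).ne'
    -- The constant `c * ρ₀ t₀ ^ 2` is chosen so that the third component equals `c` at `t₀`.
    have heq : ∀ t, ξ₂ t = ![0, 0, c * ρ₀ t₀ ^ 2 / ρ₀ t ^ 2, 0] :=
      h₂.variational.eq_of_eq hF hwave (SlowWave.isVariational_z hF hwave _) (t₀ := t₀)
        (by simp [hc, hz, hp])
    have hlim := tendsto_nhds_unique h₂.normalised
      ((SlowWave.tendsto_z hwave hx₀ (c * ρ₀ t₀ ^ 2)).congr fun t => by simp [heq t])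
    have hval : c * ρ₀ t₀ ^ 2 = x₀ ^ 2 :=
      ((div_eq_one_iff_eq (pow_ne_zero 2 hx₀.ne')).1 hlim.symm)
    intro t
    rw [heq t, hval]
  refine ⟨hξ₂, fun t _ ξ₃ _ h3 => ?_, fun ξ₃ hvar _ h3 t => ?_⟩
  · rw [hξ₂ t]
    exact SlowWave.Pxze_wave hwave t h3
  -- Since `ε' = 0`, the `ε` component of a variational solution keeps its value `1` from `t₀`.
  · rw [hξ₂ t]
    exact SlowWave.Pxze_wave hwave t ((hvar.three_eq hF t t₀).trans h3)
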